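/- Let $G=(V,E)$ be a finite simple graph. A \emph{Pauli string} of length $m$ is a tensor product of $m$ matrices from $\{\mathbb{1},X,Y,Z\}$ acting on $(\mathbb{C}^2)^{\otimes m}$; any two Pauli strings either commute or anticommute. A \emph{realization} of $G$ is a family $(S_i)_{i\in V}$ of Pauli strings of a common length such that, for all $i,j\in V$, $S_i$ and $S_j$ anticommute if and only if $i$ and $j$ are adjacent (every finite graph has a realization). For $w\in\mathbb{R}_{\ge 0}^V$ the \emph{weighted beta number} is $$\beta(G,w)=\sup_{\rho}\sum_{i\in V} w_i\,\bigl(\operatorname{tr}(\rho S_i)\bigr)^2,$$ the supremum being over all density matrices $\rho$ (positive semidefinite, trace one). This value is known not to depend on the realization $(S_i)$; equivalently, one may also take the supremum over all realizations. The \emph{weighted independence number} is $\alpha(G,w)=\max_{I}\sum_{i\in I}w_i$, the maximum being over all independent sets $I\subseteq V$. The graph $G$ is called \emph{$\hbar$-perfect} if $\beta(G,w)=\alpha(G,w)$ for every $w\in\mathbb{R}_{\ge 0}^V$. For finite simple graphs $G_1=(V_1,E_1)$ and $G_2=(V_2,E_2)$, the \emph{lexicographic product} $G_1[G_2]$ has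 vertex set $V_1\times V_2$, with $(i,j)$ and $(i',j')$ adjacent if and only if $i$ and $i'$ are adjacent in $G_1$, or $i=i'$ and $j$ and $j'$ are adjacent in $G_2$. \textbf{Theorem.} Let $G_1$ and $G_2$ be finite simple graphs. (a) For every $w=(w_{ij})\in\mathbb{R}_{\ge 0}^{V_1\times V_2}$, $$\beta(G_1[G_2],w)\le \beta\Bigl(G_1,\bigl(\beta(G_2,(w_{ij})_{j\in V_2})\bigr)_{i\in V_1}\Bigr).$$ (b) If $G_1$ and $G_2$ are $\hbar$-perfect, then $G_1[G_2]$ is $\hbar$-perfect. -/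

import Mathlib

open scoped Matrix ComplexOrder

/-- Labels of the four single-qubit Pauli matrices (the identity included). -/
inductive Pauli where
  | I | X | Y | Z
  deriving DecidableEq

/-- The `2 × 2` Pauli matrices. -/
def Pauli.mat : Pauli → Matrix (Fin 2) (Fin 2) ℂ
  | .I => 1
  | .X => !![0, 1; 1, 0]
  | .Y => !![0, -Complex.I; Complex.I, 0]
  | .Z => !![1, 0; 0, -1]

/-- A Pauli string of length `m`. -/
abbrev PauliString (m : ℕ) : Type := Fin m → Pauli

/-- The matrix of a Pauli string: the tensor product of its `m` Pauli factors, acting on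
`(ℂ²)^{⊗ m}`, whose computational basis is indexed by `Fin m → Fin 2`. -/
def PauliString.mat {m : ℕ} (S : PauliString m) :
    Matrix (Fin m → Fin 2) (Fin m → Fin 2) ℂ :=
  Matrix.of fun a b => ∏ k, (S k).mat (a k) (b k)

theorem Pauli.mat_mul_self (p : Pauli) : p.mat * p.mat = 1 := by
  cases p <;> ext i j <;> fin_cases i <;> fin_cases j <;> simp [Pauli.mat]

theorem PauliString.mat_mul_apply {m : ℕ} (S T : PauliString m) (a b : Fin m → Fin 2) :
    (S.mat * T.mat) a b = ∏ k, ((S k).mat * (T k).mat) (a k) (b k) := by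
  simp only [Matrix.mul_apply, PauliString.mat, Matrix.of_apply, ← Finset.prod_mul_distrib]
  rw [Finset.prod_univ_sum]
  simp

theorem PauliString.mat_mul_self {m : ℕ} (S : PauliString m) : S.mat * S.mat = 1 := by
  ext a b
  rw [PauliString.mat_mul_apply]
  simp only [Pauli.mat_mul_self, Matrix.one_apply]
  by_cases h : a = b
  · simp [h]
  · obtain ⟨k, hk⟩ := Function.ne_iff.mp h
    rw [if_neg h]
    exact Finset.prod_eq_zero (Finset.mem_univ k) (if_neg hk)

theorem PauliString.mat_mul_ne_zero {m : ℕ} (S T : PauliString m) : S.mat * T.mat ≠ 0 := by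
  intro h
  have h2 : S.mat * (S.mat * T.mat) * T.mat = 1 := by
    rw [← mul_assoc, S.mat_mul_self, one_mul, T.mat_mul_self]
  rw [h, mul_zero, zero_mul] at h2
  exact zero_ne_one h2

/-- Two strings cannot both commute and anticommute. -/
theorem PauliString.not_anticommute {m : ℕ} {S T : PauliString m}
    (h : S.mat * T.mat = T.mat * S.mat) : S.mat * T.mat ≠ -(T.mat * S.mat) := by
  intro h'
  rw [← h] at h'
  refine PauliString.mat_mul_ne_zero S T ?_
  ext a b
  exact self_eq_neg.mp (congrFun (congrFun h' a) b)

theorem PauliString.mat_mul_comm_sign {m : ℕ} {S T : PauliString m} (ε : Fin m → ℂ)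
    (h : ∀ k, (S k).mat * (T k).mat = ε k • ((T k).mat * (S k).mat)) :
    S.mat * T.mat = (∏ k, ε k) • (T.mat * S.mat) := by
  ext a b
  rw [Matrix.smul_apply, PauliString.mat_mul_apply, PauliString.mat_mul_apply, smul_eq_mul,
    ← Finset.prod_mul_distrib]
  refine Finset.prod_congr rfl fun k _ => ?_
  rw [h k, Matrix.smul_apply, smul_eq_mul]

/-- The frustration graph of a family of Pauli strings: `i` and `j` are adjacent exactly when
the strings `S i` and `S j` anticommute. -/
def frustrationGraph {V : Type*} {m : ℕ} (S : V → PauliString m) : SimpleGraph V where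
  Adj i j := (S i).mat * (S j).mat = -((S j).mat * (S i).mat)
  symm := ⟨fun i j h => by rw [h, neg_neg]⟩
  loopless := ⟨fun _ h => PauliString.not_anticommute rfl h⟩

/-- A realization of the graph `G` by Pauli strings: a family of Pauli strings of a common length,
indexed by the vertices, with frustration graph `G`. -/
structure PauliRealization {V : Type*} (G : SimpleGraph V) where
  /-- the common length of the strings -/
  length : ℕ
  /-- the strings -/
  string : V → PauliString length
  /-- the frustration graph of the strings is `G` -/
  frustrationGraph_eq : frustrationGraph string = G

/-- Every finite graph is a frustration graph, so that the weighted beta number below is a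
supremum over a nonempty family. -/
theorem PauliRealization.nonempty {V : Type*} [Fintype V] (G : SimpleGraph V) :
    Nonempty (PauliRealization G) := by
  classical
  let e : V ≃ Fin (Fintype.card V) := Fintype.equivFin V
  let S : V → PauliString (Fintype.card V) := fun i k =>
    if k = e i then .X else if k < e i ∧ G.Adj i (e.symm k) then .Z else .I
  have key : ∀ i j : V, e i < e j →
      (S i).mat * (S j).mat =
        (if G.Adj i j then (-1 : ℂ) else 1) • ((S j).mat * (S i).mat) := by
    intro i j hij
    have hp := PauliString.mat_mul_comm_sign (S := S i) (T := S j)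
      (fun k => if k = e i then (if G.Adj i j then (-1 : ℂ) else 1) else 1) (by
        intro k
        have hXZ : Pauli.X.mat * Pauli.Z.mat = (-1 : ℂ) • (Pauli.Z.mat * Pauli.X.mat) := by
          ext a b; fin_cases a <;> fin_cases b <;> simp [Pauli.mat]
        by_cases h1 : k = e i
        · subst h1
          by_cases h2 : G.Adj i j
          · simp [S, hij, hij.ne, h2, h2.symm, hXZ]
          · have h3 : ¬ G.Adj j i := fun h => h2 h.symm
            simp [S, hij.ne, h2, h3, Pauli.mat]
        · by_cases h2 : k = e j
          · subst h2
            simp [S, hij.ne', hij.not_gt, Pauli.mat]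
          · simp only [S, h1, h2, if_false, one_smul]
            split_ifs <;> simp [Pauli.mat])
    rw [hp]
    simp
  refine ⟨⟨_, S, ?_⟩⟩
  have key' : ∀ i j : V, e i < e j → ((frustrationGraph S).Adj i j ↔ G.Adj i j) := by
    intro i j hij
    have h := key i j hij
    by_cases h2 : G.Adj i j
    · rw [if_pos h2, neg_one_smul] at h
      exact iff_of_true h h2
    · rw [if_neg h2, one_smul] at h
      exact iff_of_false (PauliString.not_anticommute h) h2
  ext i j
  rcases lt_trichotomy (e i) (e j) with h | h | h
  · exact key' i j h
  · rw [e.injective h]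
    simp
  · rw [SimpleGraph.adj_comm, key' j i h, SimpleGraph.adj_comm]

/-- Density matrices on `ℂ^ι`: positive semidefinite matrices of trace one. -/
def IsDensityMatrix {ι : Type*} [Fintype ι] (ρ : Matrix ι ι ℂ) : Prop :=
  ρ.PosSemidef ∧ ρ.trace = 1

/-- The expectation value `⟨A⟩_ρ = tr (ρ A)` of an observable (a Hermitian matrix, so that the
trace is a real number). -/
noncomputable def expectation {ι : Type*} [Fintype ι] (ρ A : Matrix ι ι ℂ) : ℝ :=
  (ρ * A).trace.re

/-- The supremum of `∑ i, w i * ⟨S i⟩_ρ ^ 2` over all density matrices `ρ`, for a given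
realization `(S i)` of `G`. -/
noncomputable def PauliRealization.beta {V : Type*} [Fintype V] {G : SimpleGraph V}
    (R : PauliRealization G) (w : V → ℝ) : ℝ :=
  ⨆ ρ : {ρ : Matrix (Fin R.length → Fin 2) (Fin R.length → Fin 2) ℂ // IsDensityMatrix ρ},
    ∑ i, w i * expectation ρ.1 (R.string i).mat ^ 2

/-- The weighted beta number `β(G, w)`. The value `R.beta w` is known to be the same for all
realizations `R` of `G`; taking the supremum over all of them makes `β(G, w)` a graph parameter
without a choice of realization. -/
noncomputable def weightedBeta {V : Type*} [Fintype V] (G : SimpleGraph V) (w : V → ℝ) : ℝ :=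
  ⨆ R : PauliRealization G, R.beta w

/-- The weighted independence number `α(G, w)`. -/
noncomputable def weightedAlpha {V : Type*} [Fintype V] (G : SimpleGraph V) (w : V → ℝ) : ℝ :=
  ⨆ s : {s : Finset V // G.IsIndepSet (s : Set V)}, ∑ i ∈ s.1, w i

/-- A graph is ħ-perfect if `β(G, w) = α(G, w)` for all nonnegative weights `w`. -/
def IsHbarPerfect {V : Type*} [Fintype V] (G : SimpleGraph V) : Prop :=
  ∀ w : V → ℝ, (∀ i, 0 ≤ w i) → weightedBeta G w = weightedAlpha G w

/-- The lexicographic product `G₁[G₂]`: every vertex of `G₁` is replaced by a copy of `G₂`. -/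
def lexProduct {V₁ V₂ : Type*} (G₁ : SimpleGraph V₁) (G₂ : SimpleGraph V₂) :
    SimpleGraph (V₁ × V₂) where
  Adj p q := G₁.Adj p.1 q.1 ∨ (p.1 = q.1 ∧ G₂.Adj p.2 q.2)
  symm := ⟨fun _ _ h => h.imp (fun h => h.symm) (fun h => ⟨h.1.symm, h.2.symm⟩)⟩
  loopless := ⟨fun _ h => h.elim (fun h => h.ne rfl) (fun h => h.2.ne rfl)⟩

/-! The key is that `weightedBeta G w` bounds not only Pauli strings but all Hermitian contractions
`B i` with the commutation relations of `G` (`sum_expectation_sq_le_weightedBeta`). Given a state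
`ρ`, choose Pauli strings `T i` realizing `G` and form the product of the `1 + B i ⊗ T i`. These
factors are positive, and they commute because the two signs cancel. The normalized partial trace of
`(ρ ⊗ 1) ∏ (1 + B i ⊗ T i)` is then a state in which `T i` has the expectation that `B i` has in
`ρ`, provided the mixed terms are traceless.

For (a), let `q i` be the contribution of the `i`-th copy of `G₂`, and let `β i` be its weighted
beta number. The operator `B i = (q i * β i)^(-1/2) ∑ j, w (i, j) ⟨S i j⟩ S i j` is a contraction by
Cauchy–Schwarz, satisfies `β i * ⟨B i⟩ ^ 2 = q i`, and inherits the relations of `G₁`. The key bound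
for `G₁` with weights `β` finishes the argument.

For (b), (a) and perfection of both factors bound beta by the iterated alpha, which is at most the
alpha of the product; and alpha is at most beta for every graph. -/

open scoped Kronecker

/-! ### Pauli strings: commutation signs, concatenation, independent realizations. -/

section Pauli

theorem Pauli.mat_isHermitian (p : Pauli) : p.mat.IsHermitian := by
  cases p <;> ext i j <;> fin_cases i <;> fin_cases j <;> simp [Pauli.mat]

theorem PauliString.mat_isHermitian {m : ℕ} (S : PauliString m) : S.mat.IsHermitian := by
  ext a b
  simp only [PauliString.mat, Matrix.conjTranspose_apply, Matrix.of_apply, star_prod]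
  exact Finset.prod_congr rfl fun k _ => (S k).mat_isHermitian.apply _ _

theorem Pauli.exists_mat_mul_comm_sign (p q : Pauli) :
    ∃ ε : ℂ, (ε = 1 ∨ ε = -1) ∧ p.mat * q.mat = ε • (q.mat * p.mat) := by
  by_cases h : p = q ∨ p = .I ∨ q = .I
  · refine ⟨1, Or.inl rfl, ?_⟩
    rcases h with rfl | rfl | rfl <;> simp [Pauli.mat]
  · refine ⟨-1, Or.inr rfl, ?_⟩
    cases p <;> cases q <;> simp_all [Pauli.mat]

/-- Two Pauli strings either commute or anticommute. -/
theorem PauliString.mat_commute_or_anticommute {m : ℕ} (S T : PauliString m) :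
    Commute S.mat T.mat ∨ S.mat * T.mat = -(T.mat * S.mat) := by
  choose ε hε h using fun k => Pauli.exists_mat_mul_comm_sign (S k) (T k)
  have hprod : ∏ k, ε k = 1 ∨ ∏ k, ε k = -1 := by
    refine Finset.prod_induction ε (fun z => z = 1 ∨ z = -1) ?_ (Or.inl rfl) fun k _ => hε k
    rintro a b (rfl | rfl) (rfl | rfl) <;> simp
  have key := PauliString.mat_mul_comm_sign ε h
  rcases hprod with h1 | h1 <;> rw [h1] at key
  · exact Or.inl (by rwa [one_smul] at key)
  · exact Or.inr (by rwa [neg_one_smul] at key)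

theorem PauliString.mat_commute_of_not_adj {V : Type*} {m : ℕ} {S : V → PauliString m} {i j : V}
    (h : ¬ (frustrationGraph S).Adj i j) : Commute (S i).mat (S j).mat :=
  ((S i).mat_commute_or_anticommute (S j)).resolve_right h

theorem PauliString.mat_const_I (m : ℕ) : PauliString.mat (fun _ : Fin m => Pauli.I) = 1 := by
  ext a b
  simp only [PauliString.mat, Pauli.mat, Matrix.of_apply, Matrix.one_apply]
  by_cases h : a = b
  · simp [h]
  · obtain ⟨k, hk⟩ := Function.ne_iff.mp h
    rw [if_neg h]
    exact Finset.prod_eq_zero (Finset.mem_univ k) (if_neg hk)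

theorem PauliString.mat_append {m n : ℕ} (S : PauliString m) (T : PauliString n) :
    PauliString.mat (Fin.append S T) =
      (S.mat ⊗ₖ T.mat).submatrix (Fin.appendEquiv m n).symm (Fin.appendEquiv m n).symm := by
  ext a b
  simp [PauliString.mat, Fin.prod_univ_add, Fin.appendEquiv]

theorem PauliString.mat_append_mul {m n : ℕ} (S S' : PauliString m) (T T' : PauliString n) :
    PauliString.mat (Fin.append S T) * PauliString.mat (Fin.append S' T') =
      ((S.mat * S'.mat) ⊗ₖ (T.mat * T'.mat)).submatrix
        (Fin.appendEquiv m n).symm (Fin.appendEquiv m n).symm := by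
  rw [mat_append, mat_append, Matrix.submatrix_mul_equiv, Matrix.mul_kronecker_mul]

theorem PauliString.mat_append_commute {m n : ℕ} {S S' : PauliString m} {T T' : PauliString n}
    (hS : Commute S.mat S'.mat) (hT : Commute T.mat T'.mat) :
    Commute (PauliString.mat (Fin.append S T)) (PauliString.mat (Fin.append S' T')) := by
  rw [Commute, SemiconjBy, mat_append_mul, mat_append_mul, hS.eq, hT.eq]

theorem PauliString.mat_append_anticommute_left {m n : ℕ} {S S' : PauliString m}
    {T T' : PauliString n} (hS : S.mat * S'.mat = -(S'.mat * S.mat))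
    (hT : Commute T.mat T'.mat) :
    PauliString.mat (Fin.append S T) * PauliString.mat (Fin.append S' T') =
      -(PauliString.mat (Fin.append S' T') * PauliString.mat (Fin.append S T)) := by
  rw [mat_append_mul, mat_append_mul, hS, hT.eq]
  ext a b
  simp

theorem PauliString.mat_append_anticommute_right {m n : ℕ} {S S' : PauliString m}
    {T T' : PauliString n} (hS : Commute S.mat S'.mat)
    (hT : T.mat * T'.mat = -(T'.mat * T.mat)) :
    PauliString.mat (Fin.append S T) * PauliString.mat (Fin.append S' T') =
      -(PauliString.mat (Fin.append S' T') * PauliString.mat (Fin.append S T)) := by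
  rw [mat_append_mul, mat_append_mul, hS.eq, hT]
  ext a b
  simp

/-- The string with the factor `p` at position `k` and the identity elsewhere. -/
def PauliString.single {m : ℕ} (p : Pauli) (k : Fin m) : PauliString m :=
  fun l => if l = k then p else .I

theorem PauliString.single_commute {m : ℕ} (p : Pauli) (k l : Fin m) :
    Commute (PauliString.single p k).mat (PauliString.single p l).mat := by
  have h := PauliString.mat_mul_comm_sign (S := single p k) (T := single p l) (fun _ => 1) (by
    intro x
    simp only [single]
    split_ifs <;> simp [Pauli.mat])
  simpa [Commute, SemiconjBy] using h

theorem PauliString.single_commute_of_ne {m : ℕ} (p q : Pauli) {k l : Fin m} (hkl : k ≠ l) :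
    Commute (PauliString.single p k).mat (PauliString.single q l).mat := by
  have h := PauliString.mat_mul_comm_sign (S := single p k) (T := single q l) (fun _ => 1) (by
    intro x
    simp only [single]
    split_ifs with h1 h2
    · exact absurd (h1.symm.trans h2) hkl
    all_goals simp [Pauli.mat])
  simpa [Commute, SemiconjBy] using h

theorem PauliString.single_X_anticommute_single_Z {m : ℕ} (k : Fin m) :
    (PauliString.single .X k).mat * (PauliString.single .Z k).mat =
      -((PauliString.single .Z k).mat * (PauliString.single .X k).mat) := by
  have h := PauliString.mat_mul_comm_sign (S := single .X k) (T := single .Z k)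
    (fun l => if l = k then -1 else 1) (by
      intro x
      simp only [single]
      split_ifs
      · ext a b; fin_cases a <;> fin_cases b <;> simp [Pauli.mat]
      · simp [Pauli.mat])
  simpa using h

/-- Every finite graph has a realization in which, for every vertex `k`, some Pauli string
anticommutes with the string of `k` and commutes with the strings of all other vertices. -/
theorem PauliRealization.exists_flip {V : Type*} [Fintype V] (G : SimpleGraph V) :
    ∃ (R : PauliRealization G) (Q : V → PauliString R.length),
      (∀ k, (Q k).mat * (R.string k).mat = -((R.string k).mat * (Q k).mat)) ∧
      ∀ k j, j ≠ k → Commute (Q k).mat (R.string j).mat := by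
  obtain ⟨R⟩ := PauliRealization.nonempty G
  let e : V ≃ Fin (Fintype.card V) := Fintype.equivFin V
  -- Each vertex gets a private qubit carrying `Z`. These commute with each other, so the graph is
  -- unchanged, while `X` on the private qubit of `k` detects `k` alone.
  let T : V → PauliString (R.length + Fintype.card V) := fun i =>
    Fin.append (R.string i) (PauliString.single .Z (e i))
  have hT : frustrationGraph T = G := by
    have hR : ∀ i j, (frustrationGraph R.string).Adj i j ↔ G.Adj i j := by
      intro i j; rw [R.frustrationGraph_eq]
    ext i j
    rw [← hR]
    by_cases h : (frustrationGraph R.string).Adj i j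
    · exact iff_of_true
        (PauliString.mat_append_anticommute_left h (PauliString.single_commute _ _ _)) h
    · exact iff_of_false (PauliString.not_anticommute (PauliString.mat_append_commute
        (PauliString.mat_commute_of_not_adj h) (PauliString.single_commute _ _ _)).eq) h
  have hI : ∀ S : PauliString R.length,
      Commute (PauliString.mat fun _ : Fin R.length => Pauli.I) S.mat := by
    intro S
    rw [PauliString.mat_const_I]
    exact Commute.one_left _
  refine ⟨⟨_, T, hT⟩, fun k => Fin.append (fun _ => .I) (PauliString.single .X (e k)), ?_, ?_⟩
  · intro k
    exact PauliString.mat_append_anticommute_right (hI _)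
      (PauliString.single_X_anticommute_single_Z _)
  · intro k j hjk
    exact PauliString.mat_append_commute (hI _)
      (PauliString.single_commute_of_ne _ _ (e.injective.ne hjk.symm))

end Pauli

/-! ### Positivity and the transfer of expectation values from contractions to strings. -/

section PosSemidef

variable {n κ V : Type*} [Fintype n] [DecidableEq n] [Fintype κ] [DecidableEq κ]

open scoped MatrixOrder in
theorem Matrix.PosSemidef.mul_of_commute {A B : Matrix n n ℂ} (hA : A.PosSemidef)
    (hB : B.PosSemidef) (h : Commute A B) : (A * B).PosSemidef :=
  Matrix.nonneg_iff_posSemidef.mp (Commute.mul_nonneg hA.nonneg hB.nonneg h)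

theorem Matrix.PosSemidef.noncommProd {A : V → Matrix n n ℂ} (hA : ∀ i, (A i).PosSemidef)
    (s : Finset V) (comm : (s : Set V).Pairwise (Function.onFun Commute A)) :
    (s.noncommProd A comm).PosSemidef := by
  induction s using Finset.cons_induction_on with
  | empty => simpa using Matrix.PosSemidef.one
  | cons a s ha ih =>
    rw [Finset.noncommProd_cons]
    refine (hA a).mul_of_commute (ih _) (Finset.noncommProd_commute _ _ _ _ fun x hx => ?_)
    exact comm (by simp) (by simp [hx]) (by rintro rfl; exact ha hx)

open scoped MatrixOrder in
theorem Matrix.PosSemidef.exists_conjTranspose_mul_self {A : Matrix n n ℂ} (hA : A.PosSemidef) :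
    ∃ C : Matrix n n ℂ, A = Cᴴ * C :=
  CStarAlgebra.nonneg_iff_eq_star_mul_self.mp hA.nonneg

theorem Matrix.PosSemidef.trace_mul_nonneg {A B : Matrix n n ℂ} (hA : A.PosSemidef)
    (hB : B.PosSemidef) : 0 ≤ (A * B).trace := by
  obtain ⟨C, rfl⟩ := hA.exists_conjTranspose_mul_self
  rw [Matrix.mul_assoc, Matrix.trace_mul_comm]
  exact (hB.mul_mul_conjTranspose_same C).trace_nonneg

theorem Matrix.IsHermitian.posSemidef_one_add {T : Matrix n n ℂ} (hT : T.IsHermitian)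
    (h : T * T = 1) : (1 + T).PosSemidef := by
  have h2 : (1 + T) = (2⁻¹ : ℂ) • ((1 + T)ᴴ * (1 + T)) := by
    rw [Matrix.conjTranspose_add, hT.eq, Matrix.conjTranspose_one, mul_add, mul_one, add_mul,
      one_mul, h]
    module
  rw [h2]
  exact (Matrix.posSemidef_conjTranspose_mul_self _).smul (by positivity)

theorem Matrix.IsHermitian.posSemidef_one_sub {T : Matrix n n ℂ} (hT : T.IsHermitian)
    (h : T * T = 1) : (1 - T).PosSemidef := by
  rw [sub_eq_add_neg]
  exact hT.neg.posSemidef_one_add (by simpa using h)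

/-- On the `±1` eigenspaces of `T` the operator acts as `1 ± B`. -/
theorem Matrix.posSemidef_one_add_kronecker {B : Matrix n n ℂ} {T : Matrix κ κ ℂ}
    (hB : (1 + B).PosSemidef) (hB' : (1 - B).PosSemidef) (hT : T.IsHermitian) (h : T * T = 1) :
    (1 + B ⊗ₖ T).PosSemidef := by
  have h2 : 1 + B ⊗ₖ T = (2⁻¹ : ℂ) • ((1 + B) ⊗ₖ (1 + T) + (1 - B) ⊗ₖ (1 - T)) := by
    ext ⟨i, j⟩ ⟨k, l⟩
    rw [← Matrix.one_kronecker_one]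
    simp only [Matrix.add_apply, Matrix.sub_apply, Matrix.smul_apply, Matrix.kronecker_apply,
      smul_eq_mul]
    ring
  rw [h2]
  exact ((hB.kronecker (hT.posSemidef_one_add h)).add
    (hB'.kronecker (hT.posSemidef_one_sub h))).smul (by positivity)

/-- Conjugation by the involution `Q` preserves the trace but negates `A`. -/
theorem Matrix.trace_eq_zero_of_anticommute {A Q : Matrix n n ℂ} (hQ : Q * Q = 1)
    (h : Q * A = -(A * Q)) : A.trace = 0 := by
  refine self_eq_neg.mp ?_
  calc A.trace = (Q * A * Q).trace := by rw [Matrix.trace_mul_cycle, hQ, one_mul]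
    _ = -A.trace := by rw [h, neg_mul, mul_assoc, hQ, mul_one, Matrix.trace_neg]

/-- When the product is expanded, every term other than `M` contains some `F k` exactly once, so it
anticommutes with `Q k` and is traceless. -/
theorem Matrix.trace_mul_noncommProd_one_add {M : Matrix n n ℂ} {F Q : V → Matrix n n ℂ}
    (s : Finset V) (comm : (s : Set V).Pairwise (Function.onFun Commute fun i => 1 + F i))
    (hQ : ∀ k, Q k * Q k = 1) (hM : ∀ k ∈ s, Commute (Q k) M)
    (hF : ∀ k, Q k * F k = -(F k * Q k)) (hF' : ∀ k j, j ≠ k → Commute (Q k) (F j)) :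
    (M * s.noncommProd (fun i => 1 + F i) comm).trace = M.trace := by
  induction s using Finset.cons_induction_on with
  | empty => simp
  | cons a s ha ih =>
    rw [Finset.noncommProd_cons]
    set P := s.noncommProd (fun i => 1 + F i) _
    have hP : Commute (Q a) P := Finset.noncommProd_commute _ _ _ _ fun x hx =>
      (Commute.one_right _).add_right (hF' a x (by rintro rfl; exact ha hx))
    have h0 : (M * (F a * P)).trace = 0 := by
      refine Matrix.trace_eq_zero_of_anticommute (hQ a) ?_
      rw [← mul_assoc, (hM a (by simp)).eq, mul_assoc, ← mul_assoc (Q a), hF, neg_mul, mul_assoc,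
        hP.eq]
      simp only [mul_neg, mul_assoc]
    rw [add_mul, one_mul, mul_add, Matrix.trace_add, h0, add_zero]
    exact ih _ fun k hk => hM k (by simp [hk])

/-- Hermitian contractions with the commutation relations of a family of traceless independent
involutions have their expectation values reproduced by the latter. -/
theorem exists_isDensityMatrix_expectation_eq [Fintype V] [Nonempty κ] {ρ : Matrix n n ℂ}
    (hρ : IsDensityMatrix ρ) {B : V → Matrix n n ℂ} {T Q : V → Matrix κ κ ℂ}
    (hB : ∀ i, (1 + B i).PosSemidef) (hB' : ∀ i, (1 - B i).PosSemidef)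
    (hT : ∀ i, (T i).IsHermitian) (hTT : ∀ i, T i * T i = 1) (hQQ : ∀ i, Q i * Q i = 1)
    (hQ : ∀ k, Q k * T k = -(T k * Q k)) (hQ' : ∀ k j, j ≠ k → Commute (Q k) (T j))
    (hBT : ∀ i j, i ≠ j → (Commute (B i) (B j) ∧ Commute (T i) (T j)) ∨
      (B i * B j = -(B j * B i) ∧ T i * T j = -(T j * T i))) :
    ∃ σ : Matrix κ κ ℂ, IsDensityMatrix σ ∧ ∀ i, expectation σ (T i) = expectation ρ (B i) := by
  classical
  let F : V → Matrix (n × κ) (n × κ) ℂ := fun i => B i ⊗ₖ T i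
  let Q' : V → Matrix (n × κ) (n × κ) ℂ := fun i => 1 ⊗ₖ Q i
  have comm : ((Finset.univ : Finset V) : Set V).Pairwise
      (Function.onFun Commute fun i => 1 + F i) := by
    intro i _ j _ hij
    refine (Commute.one_left _).add_left ((Commute.one_right _).add_right ?_)
    rw [Commute, SemiconjBy, ← Matrix.mul_kronecker_mul, ← Matrix.mul_kronecker_mul]
    rcases hBT i j hij with ⟨h1, h2⟩ | ⟨h1, h2⟩
    · rw [h1.eq, h2.eq]
    · rw [h1, h2]
      ext a b
      simp
  have hQ'Q' : ∀ k, Q' k * Q' k = 1 := fun k => by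
    simp only [Q', ← Matrix.mul_kronecker_mul, hQQ, mul_one, Matrix.one_kronecker_one]
  have hF : ∀ k, Q' k * F k = -(F k * Q' k) := fun k => by
    simp only [Q', F, ← Matrix.mul_kronecker_mul, hQ, mul_one, one_mul]
    ext a b
    simp
  have hF' : ∀ k j, j ≠ k → Commute (Q' k) (F j) := fun k j h => by
    rw [Commute, SemiconjBy]
    simp only [Q', F, ← Matrix.mul_kronecker_mul, (hQ' k j h).eq, mul_one, one_mul]
  set P := Finset.univ.noncommProd (fun i => 1 + F i) comm with hP
  have hPpos : P.PosSemidef := Matrix.PosSemidef.noncommProd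
    (fun i => Matrix.posSemidef_one_add_kronecker (hB i) (hB' i) (hT i) (hTT i)) _ comm
  -- `(ρ ⊗ 1) * P` need not be positive; splitting `ρ` as `Cᴴ * C` and cycling gives a positive `M`
  -- with the same partial trace over `n`.
  obtain ⟨C, hC⟩ := hρ.1.exists_conjTranspose_mul_self
  set M := (C ⊗ₖ (1 : Matrix κ κ ℂ)) * P * (C ⊗ₖ (1 : Matrix κ κ ℂ))ᴴ with hM
  have hMpos : M.PosSemidef := hPpos.mul_mul_conjTranspose_same _
  let σ : Matrix κ κ ℂ := (Fintype.card κ : ℂ)⁻¹ •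
    ∑ x, M.submatrix (fun a => (x, a)) (fun a => (x, a))
  have hcard : (Fintype.card κ : ℂ) ≠ 0 := Nat.cast_ne_zero.mpr Fintype.card_ne_zero
  have htr : ∀ A, (σ * A).trace = (Fintype.card κ : ℂ)⁻¹ * ((ρ ⊗ₖ A) * P).trace := by
    intro A
    have h1 : ((ρ ⊗ₖ A) * P).trace = (M * (1 ⊗ₖ A)).trace := by
      have h2 : ρ ⊗ₖ A = (C ⊗ₖ (1 : Matrix κ κ ℂ))ᴴ * (1 ⊗ₖ A) * (C ⊗ₖ 1) := by
        rw [Matrix.conjTranspose_kronecker, ← Matrix.mul_kronecker_mul,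
          ← Matrix.mul_kronecker_mul, hC]
        simp
      rw [h2, hM, Matrix.trace_mul_comm, ← mul_assoc, Matrix.trace_mul_comm]
      simp only [mul_assoc]
    rw [h1]
    simp only [σ, Matrix.smul_mul, Matrix.trace_smul, smul_eq_mul, Matrix.sum_mul,
      Matrix.trace_sum]
    congr 1
    simp only [Matrix.trace, Matrix.diag, Matrix.mul_apply, Fintype.sum_prod_type,
      Matrix.submatrix_apply, Matrix.kronecker_apply, Matrix.one_apply]
    simp
  refine ⟨σ, ⟨(Matrix.posSemidef_sum _ fun x _ => hMpos.submatrix _).smul (by positivity), ?_⟩,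
    fun i => ?_⟩
  · have h1 := htr 1
    rw [mul_one, hP, Matrix.trace_mul_noncommProd_one_add (Q := Q') _ comm hQ'Q' ?_ hF hF',
      Matrix.trace_kronecker, hρ.2, Matrix.trace_one, one_mul, inv_mul_cancel₀ hcard] at h1
    · exact h1
    · intro k _
      rw [Commute, SemiconjBy]
      simp only [Q', ← Matrix.mul_kronecker_mul, mul_one, one_mul]
  · have h1 := htr (T i)
    have comm' := comm.mono (Finset.coe_subset.mpr (Finset.erase_subset i Finset.univ))
    -- Since `T i` squares to `1`, `(ρ ⊗ T i) * (1 + F i) = ρ ⊗ T i + ρ * B i ⊗ 1`. The first term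
    -- is traceless, the second gives the wanted value, and the remaining factors drop out by the
    -- flips `Q' k` with `k ≠ i`.
    have hPi : P = (1 + F i) * (Finset.univ.erase i).noncommProd (fun i => 1 + F i) comm' :=
      (Finset.mul_noncommProd_erase _ (Finset.mem_univ i) _ comm comm').symm
    rw [hPi, ← mul_assoc,
      Matrix.trace_mul_noncommProd_one_add (Q := Q') _ _ hQ'Q' ?_ hF hF', mul_add, mul_one,
      Matrix.trace_add, ← Matrix.mul_kronecker_mul, hTT, Matrix.trace_kronecker,
      Matrix.trace_kronecker, Matrix.trace_eq_zero_of_anticommute (hQQ i) (hQ i), mul_zero,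
      zero_add, Matrix.trace_one, mul_comm (ρ * B i).trace, inv_mul_cancel_left₀ hcard] at h1
    · rw [expectation, expectation, h1]
    · intro k hk
      have hki : i ≠ k := (Finset.ne_of_mem_erase hk).symm
      refine Commute.mul_right ?_ ((Commute.one_right _).add_right (hF' k i hki))
      rw [Commute, SemiconjBy]
      simp only [Q', ← Matrix.mul_kronecker_mul, mul_one, one_mul, (hQ' k i hki).eq]

end PosSemidef

/-! ### The weighted beta and independence numbers. -/

section Beta

variable {n V : Type*} [Fintype n] [DecidableEq n] [Fintype V] {G : SimpleGraph V}

theorem expectation_sum {W : Type*} (s : Finset W) (ρ : Matrix n n ℂ) (c : W → ℝ)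
    (A : W → Matrix n n ℂ) :
    expectation ρ (∑ j ∈ s, (c j : ℂ) • A j) = ∑ j ∈ s, c j * expectation ρ (A j) := by
  simp [expectation, Matrix.mul_sum, Matrix.trace_sum]

theorem expectation_sq_le_one {ρ A : Matrix n n ℂ} (hρ : IsDensityMatrix ρ)
    (hA : (1 + A).PosSemidef) (hA' : (1 - A).PosSemidef) : expectation ρ A ^ 2 ≤ 1 := by
  have h1 := (Complex.le_def.mp (hρ.1.trace_mul_nonneg hA)).1
  have h2 := (Complex.le_def.mp (hρ.1.trace_mul_nonneg hA')).1
  rw [mul_add, mul_one, Matrix.trace_add, hρ.2] at h1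
  rw [mul_sub, mul_one, Matrix.trace_sub, hρ.2] at h2
  simp only [Complex.zero_re, Complex.add_re, Complex.sub_re, Complex.one_re] at h1 h2
  rw [sq_le_one_iff_abs_le_one, abs_le, expectation]
  constructor <;> linarith

/-- Testing the bound on the normalized projection onto `x` controls the quadratic form of `A` at
`x`. -/
theorem Matrix.IsHermitian.posSemidef_one_add_of_expectation {A : Matrix n n ℂ}
    (hA : A.IsHermitian) (h : ∀ τ, IsDensityMatrix τ → expectation τ A ^ 2 ≤ 1) :
    (1 + A).PosSemidef := by
  have hA' : (1 + A).IsHermitian := Matrix.isHermitian_one.add hA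
  refine .of_dotProduct_mulVec_nonneg hA' fun x => ?_
  rcases eq_or_ne x 0 with rfl | hx
  · simp
  have hpos : 0 < star x ⬝ᵥ x := Matrix.dotProduct_star_self_pos_iff.mpr hx
  obtain ⟨N, hN, hNx⟩ : ∃ N : ℝ, 0 < N ∧ star x ⬝ᵥ x = N :=
    ⟨(star x ⬝ᵥ x).re, (Complex.lt_def.mp hpos).1, Complex.ext rfl (Complex.lt_def.mp hpos).2.symm⟩
  have hτ : IsDensityMatrix ((N⁻¹ : ℂ) • Matrix.vecMulVec x (star x)) := by
    refine ⟨(Matrix.posSemidef_vecMulVec_self_star x).smul ?_, ?_⟩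
    · exact_mod_cast (inv_pos.mpr hN).le
    · rw [Matrix.trace_smul, Matrix.trace_vecMulVec, dotProduct_comm, hNx, smul_eq_mul,
        inv_mul_cancel₀ (by exact_mod_cast hN.ne')]
  have hexp : expectation ((N⁻¹ : ℂ) • Matrix.vecMulVec x (star x)) A =
      N⁻¹ * (star x ⬝ᵥ A *ᵥ x).re := by
    rw [expectation, Matrix.smul_mul, Matrix.trace_smul, Matrix.vecMulVec_mul,
      Matrix.trace_vecMulVec, dotProduct_comm, ← Matrix.dotProduct_mulVec, smul_eq_mul,
      ← Complex.ofReal_inv, Complex.re_ofReal_mul]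
  have h1 := h _ hτ
  rw [hexp, sq_le_one_iff_abs_le_one, abs_le] at h1
  have h2 : -N ≤ (star x ⬝ᵥ A *ᵥ x).re := by
    have := mul_le_mul_of_nonneg_left h1.1 hN.le
    rwa [mul_inv_cancel_left₀ hN.ne', mul_neg_one] at this
  refine Complex.le_def.mpr ⟨?_, ?_⟩
  · rw [Matrix.add_mulVec, Matrix.one_mulVec, dotProduct_add, hNx]
    simp only [Complex.zero_re, Complex.add_re, Complex.ofReal_re]
    linarith
  · exact (hA'.im_star_dotProduct_mulVec_self x).symm

theorem Matrix.IsHermitian.posSemidef_one_sub_of_expectation {A : Matrix n n ℂ}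
    (hA : A.IsHermitian) (h : ∀ τ, IsDensityMatrix τ → expectation τ A ^ 2 ≤ 1) :
    (1 - A).PosSemidef := by
  rw [sub_eq_add_neg]
  refine hA.neg.posSemidef_one_add_of_expectation fun τ hτ => ?_
  simpa [expectation] using h τ hτ

theorem PauliString.expectation_sq_le_one {m : ℕ} (S : PauliString m)
    {ρ : Matrix (Fin m → Fin 2) (Fin m → Fin 2) ℂ} (hρ : IsDensityMatrix ρ) :
    expectation ρ S.mat ^ 2 ≤ 1 :=
  _root_.expectation_sq_le_one hρ (S.mat_isHermitian.posSemidef_one_add S.mat_mul_self)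
    (S.mat_isHermitian.posSemidef_one_sub S.mat_mul_self)

theorem PauliRealization.sum_le (R : PauliRealization G) {w : V → ℝ} (hw : ∀ i, 0 ≤ w i)
    {ρ : Matrix (Fin R.length → Fin 2) (Fin R.length → Fin 2) ℂ} (hρ : IsDensityMatrix ρ) :
    ∑ i, w i * expectation ρ (R.string i).mat ^ 2 ≤ ∑ i, w i :=
  Finset.sum_le_sum fun i _ =>
    mul_le_of_le_one_right (hw i) ((R.string i).expectation_sq_le_one hρ)

/-- An unbounded real supremum is `0` by default, so both suprema need the uniform bound by the
total weight. -/
theorem PauliRealization.sum_le_weightedBeta (R : PauliRealization G) {w : V → ℝ}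
    (hw : ∀ i, 0 ≤ w i) {ρ : Matrix (Fin R.length → Fin 2) (Fin R.length → Fin 2) ℂ}
    (hρ : IsDensityMatrix ρ) :
    ∑ i, w i * expectation ρ (R.string i).mat ^ 2 ≤ weightedBeta G w := by
  have h1 : ∑ i, w i * expectation ρ (R.string i).mat ^ 2 ≤ R.beta w :=
    le_ciSup (f := fun ρ : {ρ // IsDensityMatrix ρ} =>
        ∑ i, w i * expectation ρ.1 (R.string i).mat ^ 2)
      ⟨∑ i, w i, by rintro _ ⟨τ, rfl⟩; exact R.sum_le hw τ.2⟩ ⟨ρ, hρ⟩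
  refine h1.trans (le_ciSup (f := fun R : PauliRealization G => R.beta w) ⟨∑ i, w i, ?_⟩ R)
  rintro _ ⟨R', rfl⟩
  exact Real.iSup_le (fun τ => R'.sum_le hw τ.2) (Finset.sum_nonneg fun i _ => hw i)

theorem weightedBeta_le {w : V → ℝ} {a : ℝ} (ha : 0 ≤ a)
    (h : ∀ (R : PauliRealization G) (ρ : Matrix (Fin R.length → Fin 2) (Fin R.length → Fin 2) ℂ),
      IsDensityMatrix ρ → ∑ i, w i * expectation ρ (R.string i).mat ^ 2 ≤ a) :
    weightedBeta G w ≤ a :=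
  Real.iSup_le (fun R => Real.iSup_le (fun ρ => h R ρ.1 ρ.2) ha) ha

theorem weightedBeta_nonneg {w : V → ℝ} (hw : ∀ i, 0 ≤ w i) : 0 ≤ weightedBeta G w :=
  Real.iSup_nonneg fun _ => Real.iSup_nonneg fun _ =>
    Finset.sum_nonneg fun i _ => mul_nonneg (hw i) (sq_nonneg _)

/-- The weighted beta number bounds the expectation values of all families of Hermitian
contractions with the commutation relations prescribed by the graph. -/
theorem sum_expectation_sq_le_weightedBeta {w : V → ℝ} (hw : ∀ i, 0 ≤ w i) {ρ : Matrix n n ℂ}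
    (hρ : IsDensityMatrix ρ) {B : V → Matrix n n ℂ} (hB : ∀ i, (1 + B i).PosSemidef)
    (hB' : ∀ i, (1 - B i).PosSemidef) (hadj : ∀ i j, G.Adj i j → B i * B j = -(B j * B i))
    (hcomm : ∀ i j, i ≠ j → ¬ G.Adj i j → Commute (B i) (B j)) :
    ∑ i, w i * expectation ρ (B i) ^ 2 ≤ weightedBeta G w := by
  -- `weightedBeta` is a supremum over realizations, so one convenient realization suffices.
  obtain ⟨R, Q, hQ, hQ'⟩ := PauliRealization.exists_flip G
  have hR : ∀ i j, (frustrationGraph R.string).Adj i j ↔ G.Adj i j := by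
    intro i j; rw [R.frustrationGraph_eq]
  obtain ⟨σ, hσ, h⟩ := exists_isDensityMatrix_expectation_eq (T := fun i => (R.string i).mat)
    (Q := fun i => (Q i).mat) hρ hB hB' (fun i => (R.string i).mat_isHermitian)
    (fun i => (R.string i).mat_mul_self) (fun i => (Q i).mat_mul_self) hQ hQ' (by
      intro i j hij
      by_cases hG : G.Adj i j
      · exact Or.inr ⟨hadj i j hG, (hR i j).mpr hG⟩
      · exact Or.inl ⟨hcomm i j hij hG,
          PauliString.mat_commute_of_not_adj (mt (hR i j).mp hG)⟩)
  have key := R.sum_le_weightedBeta hw hσ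
  simpa only [h] using key

theorem sum_le_weightedBeta_of_isIndepSet {w : V → ℝ} (hw : ∀ i, 0 ≤ w i) {s : Finset V}
    (hs : G.IsIndepSet (s : Set V)) : ∑ i ∈ s, w i ≤ weightedBeta G w := by
  classical
  -- The indicator of `s`, as scalars on a one-dimensional space, is an admissible family: along an
  -- edge one of the two scalars is `0`, so they anticommute trivially.
  have hρ : IsDensityMatrix (1 : Matrix Unit Unit ℂ) := ⟨.one, by simp⟩
  have h := sum_expectation_sq_le_weightedBeta (G := G) hw hρ
    (B := fun i => if i ∈ s then 1 else 0)
    (by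
      intro i
      split_ifs
      · exact Matrix.PosSemidef.one.add .one
      · simpa using Matrix.PosSemidef.one)
    (by
      intro i
      split_ifs
      · simpa using Matrix.PosSemidef.zero
      · simpa using Matrix.PosSemidef.one)
    (by
      intro i j hij
      have : ¬ (i ∈ s ∧ j ∈ s) := fun h => hs h.1 h.2 hij.ne hij
      by_cases h1 : i ∈ s <;> by_cases h2 : j ∈ s <;> simp_all)
    (by
      intro i j _ _
      split_ifs <;> simp)
  refine le_trans (le_of_eq ?_) h
  rw [← Finset.sum_subset (Finset.subset_univ s) fun i _ hi => by simp [expectation, hi]]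
  exact Finset.sum_congr rfl fun i hi => by simp [expectation, hi]

theorem weightedAlpha_le_weightedBeta {w : V → ℝ} (hw : ∀ i, 0 ≤ w i) :
    weightedAlpha G w ≤ weightedBeta G w :=
  Real.iSup_le (fun s => sum_le_weightedBeta_of_isIndepSet hw s.2) (weightedBeta_nonneg hw)

theorem sum_le_weightedAlpha (w : V → ℝ) {s : Finset V} (hs : G.IsIndepSet (s : Set V)) :
    ∑ i ∈ s, w i ≤ weightedAlpha G w :=
  le_ciSup (f := fun s : {s : Finset V // G.IsIndepSet (s : Set V)} => ∑ i ∈ s.1, w i)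
    (Set.finite_range _).bddAbove ⟨s, hs⟩

theorem exists_isIndepSet_sum_eq_weightedAlpha (G : SimpleGraph V) (w : V → ℝ) :
    ∃ s : Finset V, G.IsIndepSet (s : Set V) ∧ ∑ i ∈ s, w i = weightedAlpha G w := by
  have : Nonempty {s : Finset V // G.IsIndepSet (s : Set V)} := ⟨⟨∅, by simp⟩⟩
  obtain ⟨s, hs⟩ := exists_eq_ciSup_of_finite
    (f := fun s : {s : Finset V // G.IsIndepSet (s : Set V)} => ∑ i ∈ s.1, w i)
  exact ⟨s.1, s.2, hs⟩

end Beta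

/-! ### The lexicographic product. -/

section LexProduct

variable {V₁ V₂ : Type*} [Fintype V₁] [Fintype V₂] (G₁ : SimpleGraph V₁) (G₂ : SimpleGraph V₂)

/-- A realization of the lexicographic product restricts to a realization of each copy of `G₂`. -/
def PauliRealization.fiber {G₁ : SimpleGraph V₁} {G₂ : SimpleGraph V₂}
    (R : PauliRealization (lexProduct G₁ G₂)) (i : V₁) : PauliRealization G₂ where
  length := R.length
  string j := R.string (i, j)
  frustrationGraph_eq := by
    ext j k
    have h : (frustrationGraph R.string).Adj (i, j) (i, k) ↔
        (lexProduct G₁ G₂).Adj (i, j) (i, k) := by rw [R.frustrationGraph_eq]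
    simpa [lexProduct, frustrationGraph] using h

theorem weightedBeta_lexProduct_le {w : V₁ × V₂ → ℝ} (hw : ∀ p, 0 ≤ w p) :
    weightedBeta (lexProduct G₁ G₂) w ≤
      weightedBeta G₁ fun i => weightedBeta G₂ fun j => w (i, j) := by
  set β : V₁ → ℝ := fun i => weightedBeta G₂ fun j => w (i, j)
  have hβ : ∀ i, 0 ≤ β i := fun i => weightedBeta_nonneg fun j => hw (i, j)
  refine weightedBeta_le (weightedBeta_nonneg hβ) fun R ρ hρ => ?_
  let S : V₁ → V₂ → Matrix (Fin R.length → Fin 2) (Fin R.length → Fin 2) ℂ :=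
    fun i j => (R.string (i, j)).mat
  let q : V₁ → ℝ := fun i => ∑ j, w (i, j) * expectation ρ (S i j) ^ 2
  have hq : ∀ i, 0 ≤ q i := fun i =>
    Finset.sum_nonneg fun j _ => mul_nonneg (hw _) (sq_nonneg _)
  have hqβ : ∀ (i : V₁) (τ : Matrix (Fin R.length → Fin 2) (Fin R.length → Fin 2) ℂ),
      IsDensityMatrix τ → ∑ j, w (i, j) * expectation τ (S i j) ^ 2 ≤ β i :=
    fun i τ hτ => (R.fiber i).sum_le_weightedBeta (fun j => hw (i, j)) hτ
  -- The factor `√(q i * β i)` is the Cauchy–Schwarz bound for the unnormalized sum. If it vanishes,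
  -- its inverse is `0` and `B i = 0`.
  let d : V₁ → V₂ → ℝ := fun i j =>
    (√(q i * β i))⁻¹ * (w (i, j) * expectation ρ (S i j))
  let B : V₁ → Matrix (Fin R.length → Fin 2) (Fin R.length → Fin 2) ℂ := fun i =>
    ∑ j, (d i j : ℂ) • S i j
  have hexp : ∀ i τ, expectation τ (B i) =
      (√(q i * β i))⁻¹ * ∑ j, w (i, j) * expectation ρ (S i j) * expectation τ (S i j) := by
    intro i τ
    simp only [B, expectation_sum, d, Finset.mul_sum, mul_assoc]
  have hherm : ∀ i, (B i).IsHermitian := by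
    intro i
    simp only [Matrix.IsHermitian, B, Matrix.conjTranspose_sum, Matrix.conjTranspose_smul]
    refine Finset.sum_congr rfl fun j _ => ?_
    rw [(R.string (i, j)).mat_isHermitian.eq]
    simp [S]
  have hcontr : ∀ i τ, IsDensityMatrix τ → expectation τ (B i) ^ 2 ≤ 1 := by
    intro i τ hτ
    have hcs : (∑ j, w (i, j) * expectation ρ (S i j) * expectation τ (S i j)) ^ 2 ≤
        q i * ∑ j, w (i, j) * expectation τ (S i j) ^ 2 := by
      refine Finset.sum_sq_le_sum_mul_sum_of_sq_le_mul _
        (fun j _ => mul_nonneg (hw _) (sq_nonneg _)) (fun j _ => mul_nonneg (hw _) (sq_nonneg _))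
        fun j _ => le_of_eq ?_
      ring
    have hle := hcs.trans (mul_le_mul_of_nonneg_left (hqβ i τ hτ) (hq i))
    rw [hexp, mul_pow, inv_pow, Real.sq_sqrt (mul_nonneg (hq i) (hβ i))]
    exact inv_mul_le_one_of_le₀ hle (mul_nonneg (hq i) (hβ i))
  have hval : ∀ i, β i * expectation ρ (B i) ^ 2 = q i := by
    intro i
    have h1 : ∑ j, w (i, j) * expectation ρ (S i j) * expectation ρ (S i j) = q i :=
      Finset.sum_congr rfl fun j _ => by ring
    rw [hexp, h1, mul_pow, inv_pow, Real.sq_sqrt (mul_nonneg (hq i) (hβ i))]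
    -- The left side is `β i * q i ^ 2 / (q i * β i)`; cancelling needs `β i > 0`, which follows
    -- from `q i ≤ β i`.
    rcases (hq i).eq_or_lt with h0 | h0
    · simp [← h0]
    · have h2 : 0 < β i := h0.trans_le (hqβ i ρ hρ)
      field_simp
  have hR : ∀ p p', (frustrationGraph R.string).Adj p p' ↔ (lexProduct G₁ G₂).Adj p p' := by
    intro p p'; rw [R.frustrationGraph_eq]
  have key := sum_expectation_sq_le_weightedBeta (G := G₁) hβ hρ
    (fun i => (hherm i).posSemidef_one_add_of_expectation (hcontr i))
    (fun i => (hherm i).posSemidef_one_sub_of_expectation (hcontr i))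
    (by
      intro i i' hii'
      have h : ∀ j j', S i j * S i' j' = -(S i' j' * S i j) := fun j j' =>
        (hR (i, j) (i', j')).mpr (Or.inl hii')
      simp only [B]
      rw [Finset.sum_mul_sum, Finset.sum_mul_sum, Finset.sum_comm, ← Finset.sum_neg_distrib]
      refine Finset.sum_congr rfl fun j' _ => ?_
      rw [← Finset.sum_neg_distrib]
      refine Finset.sum_congr rfl fun j _ => ?_
      rw [smul_mul_smul_comm, smul_mul_smul_comm, h, smul_neg, mul_comm])
    (by
      intro i i' hne hii'
      refine Commute.sum_left _ _ _ fun j _ => Commute.sum_right _ _ _ fun j' _ => ?_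
      refine ((PauliString.mat_commute_of_not_adj fun h => ?_).smul_left _).smul_right _
      rcases (hR (i, j) (i', j')).mp h with h | h
      · exact hii' h
      · exact hne h.1)
  simp only [hval] at key
  rwa [Fintype.sum_prod_type]

/-- Placing an optimal independent set of `G₂` over each vertex of an optimal independent set of
`G₁` gives an independent set of the product. -/
theorem weightedAlpha_weightedAlpha_le (w : V₁ × V₂ → ℝ) :
    weightedAlpha G₁ (fun i => weightedAlpha G₂ fun j => w (i, j)) ≤
      weightedAlpha (lexProduct G₁ G₂) w := by
  obtain ⟨s, hs, hs'⟩ := exists_isIndepSet_sum_eq_weightedAlpha G₁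
    fun i => weightedAlpha G₂ fun j => w (i, j)
  choose t ht ht' using fun i => exists_isIndepSet_sum_eq_weightedAlpha G₂ fun j => w (i, j)
  let e : (_ : V₁) × V₂ ↪ V₁ × V₂ := (Equiv.sigmaEquivProd V₁ V₂).toEmbedding
  have hind : (lexProduct G₁ G₂).IsIndepSet (((s.sigma t).map e : Finset _) : Set (V₁ × V₂)) := by
    rintro ⟨i, j⟩ hp ⟨i', j'⟩ hp' hne hadj
    simp only [e, Finset.coe_map, Set.mem_image, Finset.mem_coe, Finset.mem_sigma, Sigma.exists,
      Equiv.coe_toEmbedding, Equiv.sigmaEquivProd_apply, Prod.mk.injEq] at hp hp'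
    obtain ⟨_, _, ⟨h1, h2⟩, rfl, rfl⟩ := hp
    obtain ⟨_, _, ⟨h3, h4⟩, rfl, rfl⟩ := hp'
    rcases hadj with h | ⟨h, h'⟩
    · exact hs h1 h3 h.ne h
    · dsimp only at h h'
      subst h
      exact ht _ h2 h4 h'.ne h'
  have key := sum_le_weightedAlpha w hind
  rw [Finset.sum_map, Finset.sum_sigma] at key
  rw [← hs', ← Finset.sum_congr rfl fun i _ => ht' i]
  exact key

end LexProduct

theorem mainTheorem10 {V₁ V₂ : Type*} [Fintype V₁] [Fintype V₂]
    (G₁ : SimpleGraph V₁) (G₂ : SimpleGraph V₂) :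
    (∀ w : V₁ × V₂ → ℝ, (∀ p, 0 ≤ w p) →
      weightedBeta (lexProduct G₁ G₂) w
        ≤ weightedBeta G₁ (fun i => weightedBeta G₂ (fun j => w (i, j)))) ∧
    (IsHbarPerfect G₁ → IsHbarPerfect G₂ → IsHbarPerfect (lexProduct G₁ G₂)) := by
  refine ⟨fun w hw => weightedBeta_lexProduct_le G₁ G₂ hw, fun h₁ h₂ w hw => ?_⟩
  refine le_antisymm ?_ (weightedAlpha_le_weightedBeta hw)
  calc weightedBeta (lexProduct G₁ G₂) w
      ≤ weightedBeta G₁ (fun i => weightedBeta G₂ fun j => w (i, j)) :=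
        weightedBeta_lexProduct_le G₁ G₂ hw
    _ = weightedAlpha G₁ (fun i => weightedBeta G₂ fun j => w (i, j)) :=
        h₁ _ fun i => weightedBeta_nonneg fun j => hw (i, j)
    _ = weightedAlpha G₁ (fun i => weightedAlpha G₂ fun j => w (i, j)) := by
        congr 1
        funext i
        exact h₂ _ fun j => hw (i, j)
    _ ≤ weightedAlpha (lexProduct G₁ G₂) w := weightedAlpha_weightedAlpha_le G₁ G₂ w
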